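/- A word $w$ over the vertex set $V(G)$ of a simple graph $G$ represents $G$ if, for all distinct vertices $i,j$, the pair $\{i,j\}$ is an edge of $G$ if and only if the letters $i$ and $j$ alternate in $w$, i.e. the restriction of $w$ to the copies of $i$ and $j$ contains neither $ii$ nor $jj$ as a substring. A graph is word-representable if some word represents it, and minimal non-word-representable if it is not word-representable but each of its proper induced subgraphs is. For $n \ge 1$ let $G_n^9$ be the simple graph on the $n+4$ vertices $a, 1, 2, \dots, n, b, c, d$ in which: two distinct vertices of the sequence $a, 1, 2, \dots, n, b$ are adjacent if and only if they are not consecutive in it; $c$ is adjacent to exactly $a$ and $b$; and $d$ is adjacent to exactly $a, 1, 2, \dots, n, b$. Theorem. For every $n \ge 3$ the graph $G_n^9$ is minimal non-word-representable, and these graphs are pairwise non-isomorphic. Hence $\{G_n^9 : n \ge 3\}$ is an infinite class of minimal non-word-representable graphs. -/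

import Mathlib

/-- Two letters `i`, `j` alternate in the word `w`: the restriction of `w` to the copies of
`i` and `j` contains neither `ii` nor `jj` as a substring, that is, any two consecutive letters
of the restriction are different. -/
def LettersAlternate {V : Type*} (w : List V) (i j : V) : Prop :=
  open Classical in
  (w.filter (fun x => decide (x = i ∨ x = j))).IsChain (fun x y => x ≠ y)

/-- A graph is word-representable if some word over its vertex set has the property that two
distinct vertices are adjacent exactly when they alternate in the word. -/
def IsWordRepresentable {V : Type*} (G : SimpleGraph V) : Prop :=
  ∃ w : List V, ∀ i j : V, i ≠ j → (G.Adj i j ↔ LettersAlternate w i j)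

/-- A graph is minimal non-word-representable if it is not word-representable but each of its
proper induced subgraphs is. -/
def IsMinimalNonWordRepresentable {V : Type*} (G : SimpleGraph V) : Prop :=
  ¬ IsWordRepresentable G ∧
    ∀ s : Set V, s ≠ Set.univ → IsWordRepresentable (G.induce s)

/-- The vertices of `G_n^9`: the vertex `c` of the first level, the `n + 2` vertices
`a, 1, 2, …, n, b` of the second level (in this order, so that `mid 0` is `a`, `mid k` is the
vertex `k` for `1 ≤ k ≤ n`, and `mid (Fin.last (n + 1))` is `b`), and the vertex `d` of the third
level. -/
inductive GNineVertex (n : ℕ) : Type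
  | c : GNineVertex n
  | mid (i : Fin (n + 2)) : GNineVertex n
  | d : GNineVertex n

/-- Adjacency in `G_n^9`. Inside the second level exactly the consecutive pairs of the sequence
`a, 1, 2, …, n, b` are not adjacent; `c` is adjacent to `a` and `b` only; `d` is adjacent to all
vertices of the second level and to no other vertex. -/
def GNineAdj (n : ℕ) : GNineVertex n → GNineVertex n → Prop
  | .mid i, .mid j => (SimpleGraph.pathGraph (n + 2))ᶜ.Adj i j
  | .c, .mid i => i = 0 ∨ i = Fin.last (n + 1)
  | .mid i, .c => i = 0 ∨ i = Fin.last (n + 1)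
  | .d, .mid _ => True
  | .mid _, .d => True
  | .c, .c => False
  | .c, .d => False
  | .d, .c => False
  | .d, .d => False

/-- The graph `G_n^9`. -/
def GNine (n : ℕ) : SimpleGraph (GNineVertex n) where
  Adj := GNineAdj n
  symm := ⟨by
    rintro (_ | i | _) (_ | j | _) h
    all_goals first
      | exact h
      | exact SimpleGraph.Adj.symm h⟩
  loopless := ⟨by
    rintro (_ | i | _) h
    · exact h
    · exact SimpleGraph.irrefl _ h
    · exact h⟩

/-!
A word represents a graph through the numbers of copies of each letter in its prefixes: two letters
`i`, `j` alternate exactly when, over all prefixes, the count of `i` minus the count of `j` stays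
in `{0, 1}`, or stays in `{-1, 0}` (`lettersAlternate_iff`). Orienting an edge from the letter that
is ahead gives the usual semi-transitive orientation, in a form that can be computed with.

*Non-representability.* Lower by one the count of every neighbour of `d` that is ahead of `d`; this
plays the role of rotating the word so that `d` becomes a source. Afterwards all counts of the
second level lie within one of each other, so two of its vertices are adjacent exactly when their
counts are comparable as functions. Since the second level is the complement of the path
`a, 1, …, n, b`, transitivity forces the vertex `2` to lie between `a` and `b`
(`copath_between`). The count of `c`, suitably lowered too, is comparable with those of `a` and `b`.
If it lies between them, then `c` alternates with `d`; otherwise it lies on one side of both, and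
`c` alternates with `2`. Neither pair is an edge.

*Minimality.* Every proper induced subgraph is a comparability graph. The second level is ordered by
`x < y` iff `x + 2 ≤ y`. If a vertex `k` of the second level is deleted, put `d` in place of `k`,
above everything before `k` and below everything after it, and put `c` between `a` and `b`; the same
order serves when `d` is deleted. If `c` is deleted, put `d` at the bottom. The comparability graph
of a finite order is represented by a concatenation of linear extensions in which every incomparable
pair occurs in both orders (`isWordRepresentable_of_comparability`).

The graphs are pairwise non-isomorphic because they have different numbers of vertices.
-/

open Classical in
/-- The number of copies of the letter `v` among the first `k` letters of `w`. -/
noncomputable def prefixCount {V : Type*} (w : List V) (v : V) (k : ℕ) : ℤ :=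
  ((w.take k).count v : ℤ)

/-- The counting function `f` is ahead of `g`, by at most one, at all times. -/
def Leads (f g : ℕ → ℤ) : Prop := ∀ k, g k ≤ f k ∧ f k ≤ g k + 1

/-! ### Alternation in terms of prefix counts -/

lemma prefixCount_zero {V : Type*} (w : List V) (v : V) : prefixCount w v 0 = 0 := by
  simp [prefixCount]

open Classical in
lemma prefixCount_cons_succ {V : Type*} (w : List V) (x v : V) (k : ℕ) :
    prefixCount (x :: w) v (k + 1) = prefixCount w v k + if x = v then 1 else 0 := by
  simp only [prefixCount, List.take_succ_cons, List.count_cons, beq_iff_eq]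
  split_ifs <;> simp

lemma leads_prefixCount_cons {V : Type*} (w : List V) (x i j : V) :
    Leads (prefixCount (x :: w) i) (prefixCount (x :: w) j) ↔
      ∀ k, prefixCount (x :: w) j (k + 1) ≤ prefixCount (x :: w) i (k + 1) ∧
        prefixCount (x :: w) i (k + 1) ≤ prefixCount (x :: w) j (k + 1) + 1 := by
  refine ⟨fun h k => h (k + 1), fun h k => ?_⟩
  rcases k with _ | k
  · simp [prefixCount_zero]
  · exact h k

open Classical in
/-- Alternation with the letter `i` coming first, expressed by putting an extra `j` in front. -/
lemma isChain_cons_filter_iff {V : Type*} (w : List V) {i j : V} (hij : i ≠ j) :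
    (j :: w.filter (fun x => decide (x = i ∨ x = j))).IsChain (fun x y => x ≠ y) ↔
      Leads (prefixCount w i) (prefixCount w j) := by
  induction w generalizing i j with
  | nil => simp [Leads, prefixCount]
  | cons x w ih =>
    rw [leads_prefixCount_cons]
    simp only [prefixCount_cons_succ]
    by_cases hi : x = i
    · subst hi
      have h := ih hij.symm
      simp only [or_comm (b := _ = x)] at h
      simp only [List.filter_cons, true_or, decide_true, if_true, List.isChain_cons_cons, h,
        if_neg hij]
      constructor
      · rintro ⟨-, h⟩ k
        have := h k
        omega
      · intro h
        refine ⟨hij.symm, fun k => ?_⟩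
        have := h k
        omega
    · by_cases hj : x = j
      · subst hj
        simp only [List.filter_cons, or_true, decide_true, if_true, List.isChain_cons_cons, ne_eq,
          not_true_eq_false, false_and, if_neg hi, false_iff, not_forall]
        exact ⟨0, by simp [prefixCount_zero]⟩
      · simpa only [List.filter_cons, hi, hj, or_self, decide_false, if_false, add_zero,
          Bool.false_eq_true, Leads] using ih hij

lemma lettersAlternate_iff {V : Type*} (w : List V) {i j : V} (hij : i ≠ j) :
    LettersAlternate w i j ↔
      Leads (prefixCount w i) (prefixCount w j) ∨ Leads (prefixCount w j) (prefixCount w i) := by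
  classical
  have h := isChain_cons_filter_iff w hij.symm
  simp only [or_comm (b := _ = i)] at h
  rw [← isChain_cons_filter_iff w hij, ← h, LettersAlternate]
  have hmem : ∀ x ∈ w.filter (fun x => decide (x = i ∨ x = j)), x = i ∨ x = j := by
    intro x hx
    simpa using (List.mem_filter.1 hx).2
  generalize w.filter (fun x => decide (x = i ∨ x = j)) = F at hmem
  rcases F with _ | ⟨x, F⟩
  · simp
  · rcases hmem x (by simp) with rfl | rfl
    · simp [hij.symm]
    · simp [hij]

/-! ### Comparability graphs are word-representable -/

/-- If a concatenation of blocks `xy` and `yx` following a letter `y` alternates, then every block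
is `xy`. -/
lemma blocks_eq_of_isChain_cons {V : Type*} {x y : V} (L : List (List V))
    (hL : ∀ l ∈ L, l = [x, y] ∨ l = [y, x])
    (h : (y :: L.flatten).IsChain (fun x y => x ≠ y)) : ∀ l ∈ L, l = [x, y] := by
  induction L with
  | nil => simp
  | cons b L ih =>
    rcases hL b (by simp) with rfl | rfl
    · simp only [List.flatten_cons, List.cons_append, List.nil_append, List.isChain_cons_cons] at h
      have := ih (fun l hl => hL l (by simp [hl])) h.2.2
      simpa using this
    · simp at h

lemma blocks_eq_of_isChain {V : Type*} {x y : V} (L : List (List V))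
    (hL : ∀ l ∈ L, l = [x, y] ∨ l = [y, x])
    (h : L.flatten.IsChain (fun x y => x ≠ y)) :
    (∀ l ∈ L, l = [x, y]) ∨ (∀ l ∈ L, l = [y, x]) := by
  rcases L with _ | ⟨b, L⟩
  · simp
  · rcases hL b (by simp) with rfl | rfl
    · left
      simp only [List.flatten_cons, List.cons_append, List.nil_append, List.isChain_cons_cons] at h
      simpa using blocks_eq_of_isChain_cons L (fun l hl => hL l (by simp [hl])) h.2
    · right
      simp only [List.flatten_cons, List.cons_append, List.nil_append, List.isChain_cons_cons] at h
      simpa using blocks_eq_of_isChain_cons L (fun l hl => (hL l (by simp [hl])).symm) h.2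

lemma isChain_flatten_of_blocks_eq {V : Type*} {x y : V} (hxy : x ≠ y) (L : List (List V))
    (hL : ∀ l ∈ L, l = [x, y]) : L.flatten.IsChain (fun x y => x ≠ y) := by
  suffices h : (y :: L.flatten).IsChain (fun x y => x ≠ y) from h.tail
  induction L with
  | nil => simp
  | cons b L ih =>
    obtain rfl := hL b (by simp)
    have := ih (fun l hl => hL l (by simp [hl]))
    simp [hxy, hxy.symm, this]

/-- The extension adds `a < b` whenever `a ≤ x` and `y ≤ b`; this keeps the order antisymmetric
because `y ≤ x` is excluded. -/
lemma exists_isLinearOrder_extending {V : Type*} (r : V → V → Prop) [IsStrictOrder V r] {x y : V}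
    (hxy : x ≠ y) (hyx : ¬ r y x) :
    ∃ s : V → V → Prop, IsLinearOrder V s ∧ (∀ a b, r a b → s a b) ∧ s x y := by
  let le : V → V → Prop := fun a b => a = b ∨ r a b
  have le_trans : ∀ a b c, le a b → le b c → le a c := by
    rintro a b c (rfl | hab) (rfl | hbc)
    · exact .inl rfl
    · exact .inr hbc
    · exact .inr hab
    · exact .inr (_root_.trans hab hbc)
  have le_antisymm : ∀ a b, le a b → le b a → a = b := by
    rintro a b (rfl | hab) (h | hba)
    · rfl
    · rfl
    · exact h.symm
    · exact (irrefl a (_root_.trans hab hba)).elim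
  have hnle : ¬ le y x := by
    rintro (h | h)
    · exact hxy h.symm
    · exact hyx h
  let t : V → V → Prop := fun a b => le a b ∨ (le a x ∧ le y b)
  have : IsPartialOrder V t :=
    { refl := fun a => .inl (.inl rfl)
      trans := by
        rintro a b c (hab | ⟨hax, hyb⟩) (hbc | ⟨hbx, hyc⟩)
        · exact .inl (le_trans _ _ _ hab hbc)
        · exact .inr ⟨le_trans _ _ _ hab hbx, hyc⟩
        · exact .inr ⟨hax, le_trans _ _ _ hyb hbc⟩
        · exact .inr ⟨hax, hyc⟩
      antisymm := by
        rintro a b (hab | ⟨hax, hyb⟩) (hba | ⟨hbx, hya⟩)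
        · exact le_antisymm _ _ hab hba
        · exact (hnle (le_trans _ _ _ hya (le_trans _ _ _ hab hbx))).elim
        · exact (hnle (le_trans _ _ _ hyb (le_trans _ _ _ hba hax))).elim
        · exact (hnle (le_trans _ _ _ hya hax)).elim }
  obtain ⟨s, hs, hts⟩ := extend_partialOrder t
  exact ⟨s, hs, fun a b h => hts _ _ (.inl (.inr h)), hts _ _ (.inr ⟨.inl rfl, .inl rfl⟩)⟩

open Classical in
/-- A finite linear order, listed increasingly, as a word: its restriction to two letters `a`, `b`
with `a < b` is `ab`. -/
lemma exists_list_of_isLinearOrder {V : Type*} [Finite V] (s : V → V → Prop)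
    (hs : IsLinearOrder V s) :
    ∃ l : List V, ∀ a b, a ≠ b → s a b →
      l.filter (fun x => decide (x = a ∨ x = b)) = [a, b] := by
  have := Fintype.ofFinite V
  refine ⟨(Finset.univ : Finset V).sort s, fun a b hab h => ?_⟩
  refine List.Perm.eq_of_pairwise (le := s) ?_ ?_ ?_ ?_
  · intro x y _ _ hxy hyx
    exact antisymm_of s hxy hyx
  · exact (Finset.pairwise_sort _ s).filter _
  · simpa using h
  · rw [List.perm_ext_iff_of_nodup ((Finset.sort_nodup _ s).filter _) (by simpa using hab)]
    intro x
    simp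

/-- The word is a concatenation of linear extensions in which every incomparable pair occurs in both
orders. -/
theorem isWordRepresentable_of_comparability {V : Type*} [Finite V] (G : SimpleGraph V)
    (r : V → V → Prop) [IsStrictOrder V r] (hG : ∀ i j, G.Adj i j ↔ r i j ∨ r j i) :
    IsWordRepresentable G := by
  classical
  have := Fintype.ofFinite V
  -- `S` assigns to each ordered pair that `r` does not reverse a linear extension, written as a
  -- word, in which the pair occurs in the given order.
  have key : ∀ p : V × V, p.1 ≠ p.2 ∧ ¬ r p.2 p.1 → ∃ l : List V,
      (∀ a b, a ≠ b → r a b → l.filter (fun x => decide (x = a ∨ x = b)) = [a, b]) ∧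
      (∀ a b, a ≠ b → l.filter (fun x => decide (x = a ∨ x = b)) = [a, b] ∨
        l.filter (fun x => decide (x = a ∨ x = b)) = [b, a]) ∧
      l.filter (fun x => decide (x = p.1 ∨ x = p.2)) = [p.1, p.2] := by
    rintro ⟨x, y⟩ ⟨hxy, hyx⟩
    obtain ⟨s, hs, hrs, hsxy⟩ := exists_isLinearOrder_extending r hxy hyx
    obtain ⟨l, hl⟩ := exists_list_of_isLinearOrder s hs
    refine ⟨l, fun a b hab h => hl a b hab (hrs a b h), fun a b hab => ?_, hl x y hxy hsxy⟩
    rcases total_of s a b with h | h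
    · exact .inl (hl a b hab h)
    · right
      have := hl b a hab.symm h
      simpa only [or_comm (b := _ = a)] using this
  choose! S hS using key
  let L := ((Finset.univ : Finset (V × V)).filter
    (fun p => p.1 ≠ p.2 ∧ ¬ r p.2 p.1)).toList.map S
  have hL : ∀ l ∈ L, ∃ p : V × V, (p.1 ≠ p.2 ∧ ¬ r p.2 p.1) ∧ S p = l := by
    intro l hl
    simpa [L] using hl
  have hmem : ∀ x y : V, x ≠ y → ¬ r y x → S (x, y) ∈ L := by
    intro x y hxy hyx
    refine List.mem_map_of_mem ?_
    simp [hxy, hyx]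
  have hrep : ∀ i j, i ≠ j → r i j → LettersAlternate L.flatten i j := by
    intro i j hij h
    rw [LettersAlternate, List.filter_flatten]
    refine isChain_flatten_of_blocks_eq hij _ fun l hl => ?_
    obtain ⟨l', hl', rfl⟩ := List.mem_map.1 hl
    obtain ⟨p, hp, rfl⟩ := hL l' hl'
    exact (hS p hp).1 i j hij h
  refine ⟨L.flatten, fun i j hij => ⟨fun h => ?_, fun h => ?_⟩⟩
  · rcases (hG i j).1 h with h | h
    · exact hrep i j hij h
    · have := hrep j i hij.symm h
      simpa only [LettersAlternate, or_comm (b := _ = i)] using this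
  · by_contra hn
    rw [hG, not_or] at hn
    rw [LettersAlternate, List.filter_flatten] at h
    have hij' := hmem i j hij hn.2
    have hji' := hmem j i hij.symm hn.1
    have e₁ := (hS (i, j) ⟨hij, hn.2⟩).2.2
    have e₂ := (hS (j, i) ⟨hij.symm, hn.1⟩).2.2
    simp only [or_comm (b := _ = i)] at e₂
    have hblocks := blocks_eq_of_isChain _ (x := i) (y := j) (fun l hl => by
      obtain ⟨l', hl', rfl⟩ := List.mem_map.1 hl
      obtain ⟨p, hp, rfl⟩ := hL l' hl'
      exact (hS p hp).2.1 i j hij) h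
    rcases hblocks with hb | hb
    · have := hb _ (List.mem_map_of_mem hji')
      rw [e₂] at this
      exact hij (List.cons.inj this).1.symm
    · have := hb _ (List.mem_map_of_mem hij')
      rw [e₁] at this
      exact hij (List.cons.inj this).1

/-! ### Non-representability -/

/-- Lowering some letters by one creates no new alternation, since all counts start at `0`. -/
lemma lettersAlternate_of_shifted {V : Type*} {w : List V} {i j : V} (hij : i ≠ j) {s t : ℤ}
    (hs : s = 0 ∨ s = 1) (ht : t = 0 ∨ t = 1)
    (h : Leads (fun k => prefixCount w i k - s) (fun k => prefixCount w j k - t)) :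
    LettersAlternate w i j := by
  rw [lettersAlternate_iff w hij]
  have h0 := h 0
  simp only [prefixCount_zero] at h0
  rcases hs with rfl | rfl <;> rcases ht with rfl | rfl
  · left; intro k; have := h k; dsimp only at this; omega
  · right; intro k; have := h k; dsimp only at this; omega
  · omega
  · left; intro k; have := h k; dsimp only at this; omega

/-- If the comparability graph of a transitive relation is the complement of the path
`0, 1, …, n + 1` and `0` is below `2`, then `2` is below `n + 1`, hence between the two ends. -/
lemma copath_between {n : ℕ} (hn : 3 ≤ n) (r : ℕ → ℕ → Prop)
    (htrans : ∀ x y z, r x y → r y z → r x z)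
    (hcomp : ∀ x y, x + 2 ≤ y → y ≤ n + 1 → r x y ∨ r y x)
    (hincomp : ∀ x, x ≤ n → ¬ r x (x + 1) ∧ ¬ r (x + 1) x) (h : r 0 2) :
    r 2 (n + 1) := by
  have h0 : ∀ k, k + 2 ≤ n + 1 → r 0 (k + 2) := by
    intro k
    induction k with
    | zero => exact fun _ => h
    | succ k ih =>
      intro hk
      rcases hcomp 0 (k + 1 + 2) (by omega) hk with h' | h'
      · exact h'
      · exact ((hincomp (k + 2) (by omega)).2 (htrans _ _ _ h' (ih (by omega)))).elim
  have h0n : r 0 (n + 1) := by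
    have := h0 (n - 1) (by omega)
    rwa [show n - 1 + 2 = n + 1 by omega] at this
  have h1n : r 1 (n + 1) := by
    rcases hcomp 1 (n + 1) (by omega) le_rfl with h' | h'
    · exact h'
    · exact ((hincomp 0 (by omega)).1 (htrans _ _ _ h0n h')).elim
  rcases hcomp 2 (n + 1) (by omega) le_rfl with h' | h'
  · exact h'
  · exact ((hincomp 1 (by omega)).1 (htrans _ _ _ h1n h')).elim

/-- If the counts of `a` and `b`, lowered by `s` and `t`, stay within one below that of `d`, and `c`
alternates with `a` and with `b`, then `c` can be lowered so as to remain compatible with both. -/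
lemma exists_shift {a b c d : ℕ → ℤ} {s t : ℤ} (hs : s = 0 ∨ s = 1) (ht : t = 0 ∨ t = 1)
    (ha : Leads d (fun k => a k - s)) (hb : Leads d (fun k => b k - t))
    (hca : Leads c a ∨ Leads a c) (hcb : Leads c b ∨ Leads b c) :
    ∃ u : ℤ, (u = 0 ∨ u = 1) ∧
      (Leads (fun k => c k - u) (fun k => a k - s) ∨ Leads (fun k => a k - s) (fun k => c k - u)) ∧
      (Leads (fun k => c k - u) (fun k => b k - t) ∨ Leads (fun k => b k - t) (fun k => c k - u)) := by
  simp only [Leads] at *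
  rcases hs with rfl | rfl <;> rcases ht with rfl | rfl <;> rcases hca with h₁ | h₁ <;>
    rcases hcb with h₂ | h₂
  all_goals first
    | refine ⟨0, .inl rfl, ?_, ?_⟩ <;> first
        | (left; intro k; have := ha k; have := hb k; have := h₁ k; have := h₂ k; omega)
        | (right; intro k; have := ha k; have := hb k; have := h₁ k; have := h₂ k; omega)
    | refine ⟨1, .inr rfl, ?_, ?_⟩ <;> first
        | (left; intro k; have := ha k; have := hb k; have := h₁ k; have := h₂ k; omega)
        | (right; intro k; have := ha k; have := hb k; have := h₁ k; have := h₂ k; omega)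

lemma gNine_adj_mid {n : ℕ} (x y : Fin (n + 2)) :
    (GNine n).Adj (.mid x) (.mid y) ↔ x.val + 2 ≤ y.val ∨ y.val + 2 ≤ x.val := by
  change (SimpleGraph.pathGraph (n + 2))ᶜ.Adj x y ↔ _
  rw [SimpleGraph.compl_adj, SimpleGraph.pathGraph_adj, ne_eq, Fin.ext_iff]
  omega

theorem not_isWordRepresentable_gNine {n : ℕ} (hn : 3 ≤ n) : ¬ IsWordRepresentable (GNine n) := by
  rintro ⟨w, hw⟩
  let f : GNineVertex n → ℕ → ℤ := prefixCount w
  have hadj : ∀ i j, i ≠ j → (GNine n).Adj i j → Leads (f i) (f j) ∨ Leads (f j) (f i) :=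
    fun i j hij h => (lettersAlternate_iff w hij).1 ((hw i j hij).1 h)
  have hshift : ∀ x : Fin (n + 2), ∃ s : ℤ, (s = 0 ∨ s = 1) ∧
      Leads (f .d) (fun k => f (.mid x) k - s) := by
    intro x
    rcases hadj .d (.mid x) (by simp) trivial with h | h
    · exact ⟨0, .inl rfl, by simpa using h⟩
    · refine ⟨1, .inr rfl, fun k => ?_⟩
      have := h k
      dsimp only
      omega
  choose s hs hd using hshift
  -- The lowered counts of the second level; `d` is ahead of all of them.
  let g : Fin (n + 2) → ℕ → ℤ := fun x k => f (.mid x) k - s x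
  have hcomp : ∀ x y, (GNine n).Adj (.mid x) (.mid y) → g y ≤ g x ∨ g x ≤ g y := by
    intro x y h
    have key : ∀ x y, Leads (f (.mid x)) (f (.mid y)) → g y ≤ g x ∨ g x ≤ g y := by
      intro x y h
      have hx := hs x
      have hy := hs y
      by_cases hlt : s x ≤ s y
      · left; intro k; have := h k; simp only [g]; omega
      · right; intro k; have := h k; simp only [g]; omega
    rcases hadj _ _ h.ne h with h | h
    · exact key x y h
    · exact (key y x h).symm
  have hincomp : ∀ x y, x ≠ y → g y ≤ g x → (GNine n).Adj (.mid x) (.mid y) := by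
    intro x y hxy h
    rw [hw _ _ (by simpa using hxy)]
    refine lettersAlternate_of_shifted (by simpa using hxy) (hs x) (hs y) fun k => ?_
    have h₁ := h k
    have h₂ := hd x k
    have h₃ := hd y k
    simp only [g, f] at h₁ h₂ h₃
    dsimp only
    omega
  have hca : (GNine n).Adj .c (.mid 0) := Or.inl rfl
  have hcb : (GNine n).Adj .c (.mid (Fin.last (n + 1))) := Or.inr rfl
  obtain ⟨u, hu, hua, hub⟩ := exists_shift (hs 0) (hs (Fin.last (n + 1))) (hd 0)
    (hd (Fin.last (n + 1))) (hadj _ _ hca.ne hca) (hadj _ _ hcb.ne hcb)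
  let q : Fin (n + 2) := ⟨2, by omega⟩
  have hcd : ¬ LettersAlternate w .d .c := by
    rw [← hw _ _ (by simp)]
    exact id
  have hcq : ¬ (GNine n).Adj .c (.mid q) := by
    rintro (h | h)
    · simp [q, Fin.ext_iff] at h
    · simp only [q, Fin.ext_iff, Fin.val_last] at h
      omega
  have hqc₁ : ¬ LettersAlternate w .c (.mid q) := by
    rwa [← hw _ _ (by simp)]
  have hqc₂ : ¬ LettersAlternate w (.mid q) .c := by
    rw [← hw _ _ (by simp)]
    exact fun h => hcq h.symm
  -- The position of `c` relative to two of its neighbours that have the vertex `2` between them.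
  have final : ∀ p r : Fin (n + 2), g q ≤ g p → g r ≤ g q →
      (Leads (fun k => f .c k - u) (g p) ∨ Leads (g p) (fun k => f .c k - u)) →
      (Leads (fun k => f .c k - u) (g r) ∨ Leads (g r) (fun k => f .c k - u)) → False := by
    intro p r hqp hrq hp hr
    rcases hp with hp | hp
    · refine hqc₁ (lettersAlternate_of_shifted (by simp) hu (hs q) fun k => ?_)
      have h₁ := hqp k
      have h₂ := hrq k
      have h₃ := hp k
      rcases hr with hr | hr <;>
      · have h₄ := hr k
        simp only [g, f] at h₁ h₂ h₃ h₄
        dsimp only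
        omega
    · rcases hr with hr | hr
      · refine hcd (lettersAlternate_of_shifted (s := 0) (by simp) (.inl rfl) hu fun k => ?_)
        have h₁ := hp k
        have h₂ := hr k
        have h₃ := hd p k
        have h₄ := hd r k
        simp only [g, f] at h₁ h₂ h₃ h₄
        dsimp only
        omega
      · refine hqc₂ (lettersAlternate_of_shifted (by simp) (hs q) hu fun k => ?_)
        have h₁ := hqp k
        have h₂ := hrq k
        have h₃ := hp k
        have h₄ := hr k
        simp only [g, f] at h₁ h₂ h₃ h₄
        dsimp only
        omega
  -- The path relabelled by natural numbers, to apply `copath_between`.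
  let e : ℕ → Fin (n + 2) := fun x => Fin.ofNat (n + 2) x
  have he : ∀ x, x ≤ n + 1 → (e x).val = x := by
    intro x hx
    simp only [e, Fin.ofNat]
    exact Nat.mod_eq_of_lt (by omega)
  have he0 : e 0 = 0 := by ext; rw [he _ (by omega)]; rfl
  have he2 : e 2 = q := by ext; rw [he _ (by omega)]
  have hen : e (n + 1) = Fin.last (n + 1) := by ext; rw [he _ le_rfl]; rfl
  have hecomp : ∀ x y, x + 2 ≤ y → y ≤ n + 1 → g (e y) ≤ g (e x) ∨ g (e x) ≤ g (e y) := by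
    intro x y hxy hy
    refine hcomp _ _ ((gNine_adj_mid _ _).2 ?_)
    rw [he x (by omega), he y hy]
    exact .inl hxy
  have heincomp : ∀ x, x ≤ n → ¬ g (e (x + 1)) ≤ g (e x) ∧ ¬ g (e x) ≤ g (e (x + 1)) := by
    intro x hx
    have hex := he x (by omega)
    have hex' := he (x + 1) (by omega)
    have hne : e x ≠ e (x + 1) := by
      rw [ne_eq, Fin.ext_iff]
      omega
    constructor
    · intro h
      have := (gNine_adj_mid _ _).1 (hincomp _ _ hne h)
      omega
    · intro h
      have := (gNine_adj_mid _ _).1 (hincomp _ _ hne.symm h)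
      omega
  rcases hecomp 0 2 le_rfl (by omega) with h | h
  · have hb := copath_between hn (fun x y => g (e y) ≤ g (e x))
      (fun _ _ _ h₁ h₂ => h₂.trans h₁) hecomp heincomp h
    rw [he0, he2] at h
    rw [he2, hen] at hb
    exact final _ _ h hb hua hub
  · have hb := copath_between hn (fun x y => g (e x) ≤ g (e y))
      (fun _ _ _ h₁ h₂ => h₁.trans h₂) (fun x y hx hy => (hecomp x y hx hy).symm)
      (fun x hx => (heincomp x hx).symm) h
    rw [he0, he2] at h
    rw [he2, hen] at hb
    exact final _ _ hb h hub hua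

/-! ### Minimality -/

/-- `GNineVertex n` consists of the second level and two further vertices. -/
def gNineVertexEquiv (n : ℕ) : GNineVertex n ≃ Option (Option (Fin (n + 2))) where
  toFun
    | .c => none
    | .d => some none
    | .mid i => some (some i)
  invFun
    | none => .c
    | some none => .d
    | some (some i) => .mid i
  left_inv := by rintro (_ | _ | _) <;> rfl
  right_inv := by rintro (_ | _ | _) <;> rfl

instance finite_gNineVertex (n : ℕ) : Finite (GNineVertex n) :=
  Finite.of_equiv _ (gNineVertexEquiv n).symm

lemma card_gNineVertex (n : ℕ) : Nat.card (GNineVertex n) = n + 4 := by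
  rw [Nat.card_congr (gNineVertexEquiv n)]
  simp

/-- The order on the second level, with `d` in the place of its `k`-th vertex and `c` between its
two ends. It is the order of a comparability graph once `d` or the `k`-th vertex is deleted. -/
def slotOrder (n k : ℕ) : GNineVertex n → GNineVertex n → Prop
  | .mid x, .mid y => x.val + 2 ≤ y.val
  | .mid x, .d => x.val < k
  | .d, .mid y => k < y.val
  | .mid x, .c => x.val = 0
  | .c, .mid y => y.val = n + 1
  | _, _ => False

/-- The order on the second level with `d` below it; `c` is isolated. -/
def bottomOrder (n : ℕ) : GNineVertex n → GNineVertex n → Prop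
  | .mid x, .mid y => x.val + 2 ≤ y.val
  | .d, .mid _ => True
  | _, _ => False

lemma isWordRepresentable_induce_gNine {n : ℕ} (s : Set (GNineVertex n))
    (r : GNineVertex n → GNineVertex n → Prop) (hirr : ∀ x, ¬ r x x)
    (htrans : ∀ x ∈ s, ∀ y ∈ s, ∀ z ∈ s, r x y → r y z → r x z)
    (hr : ∀ x ∈ s, ∀ y ∈ s, (GNine n).Adj x y ↔ r x y ∨ r y x) :
    IsWordRepresentable ((GNine n).induce s) := by
  have : IsStrictOrder s (fun x y => r x y) :=
    { irrefl := fun x => hirr x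
      trans := fun x y z => htrans x x.2 y y.2 z z.2 }
  exact isWordRepresentable_of_comparability _ (fun x y : s => r x y)
    fun x y => hr x x.2 y y.2

lemma isWordRepresentable_induce_of_slotOrder {n k : ℕ} (hn : 1 ≤ n) (hk : k ≤ n + 1)
    (s : Set (GNineVertex n)) (hs : .d ∉ s ∨ ∀ x : Fin (n + 2), x.val = k → .mid x ∉ s) :
    IsWordRepresentable ((GNine n).induce s) := by
  have hd : .d ∈ s → ∀ x : Fin (n + 2), .mid x ∈ s → x.val ≠ k :=
    fun hd x hx hxk => hs.elim (fun h => h hd) (fun h => h x hxk hx)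
  refine isWordRepresentable_induce_gNine s (slotOrder n k) ?_ ?_ ?_
  · rintro (_ | x | _) <;> simp [slotOrder]
  · rintro (_ | x | _) hx (_ | y | _) hy (_ | z | _) hz h₁ h₂ <;> simp only [slotOrder] at * <;>
      omega
  · rintro (_ | x | _) hx (_ | y | _) hy
    case mid.mid => exact gNine_adj_mid x y
    case d.mid =>
      have := hd hx y hy
      exact iff_of_true trivial (by simp only [slotOrder]; omega)
    case mid.d =>
      have := hd hy x hx
      exact iff_of_true trivial (by simp only [slotOrder]; omega)
    case c.mid =>
      change y = 0 ∨ y = Fin.last (n + 1) ↔ y.val = n + 1 ∨ y.val = 0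
      rw [Fin.ext_iff, Fin.ext_iff, or_comm]
      rfl
    case mid.c =>
      change x = 0 ∨ x = Fin.last (n + 1) ↔ x.val = 0 ∨ x.val = n + 1
      rw [Fin.ext_iff, Fin.ext_iff]
      rfl
    all_goals simp [GNine, GNineAdj, slotOrder]

lemma isWordRepresentable_induce_of_c_notMem {n : ℕ} (s : Set (GNineVertex n)) (hs : .c ∉ s) :
    IsWordRepresentable ((GNine n).induce s) := by
  refine isWordRepresentable_induce_gNine s (bottomOrder n) ?_ ?_ ?_
  · rintro (_ | x | _) <;> simp [bottomOrder]
  · rintro (_ | x | _) hx (_ | y | _) hy (_ | z | _) hz h₁ h₂ <;>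
      simp only [bottomOrder] at *
    omega
  · rintro (_ | x | _) hx (_ | y | _) hy
    case mid.mid => exact gNine_adj_mid x y
    all_goals first
      | exact absurd hx hs
      | exact absurd hy hs
      | simp [GNine, GNineAdj, bottomOrder]

theorem mainTheorem3 :
    (∀ n : ℕ, 3 ≤ n → IsMinimalNonWordRepresentable (GNine n)) ∧
      (∀ m n : ℕ, 3 ≤ m → 3 ≤ n → m ≠ n → IsEmpty (GNine m ≃g GNine n)) := by
  refine ⟨fun n hn => ⟨not_isWordRepresentable_gNine hn, fun s hs => ?_⟩,
    fun m n _ _ hmn => ⟨fun e => hmn ?_⟩⟩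
  · obtain ⟨v, hv⟩ := (Set.ne_univ_iff_exists_notMem s).1 hs
    rcases v with _ | x | _
    · exact isWordRepresentable_induce_of_c_notMem s hv
    · refine isWordRepresentable_induce_of_slotOrder (k := x) (by omega) (by omega) s (.inr ?_)
      intro y hy
      rwa [Fin.ext hy]
    · exact isWordRepresentable_induce_of_slotOrder (k := 0) (by omega) (by omega) s (.inl hv)
  · have := Nat.card_congr e.toEquiv
    rw [card_gNineVertex, card_gNineVertex] at this
    omega
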